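/- Let $n\ge 0$ and let $\sigma$ be a permutation of $[n]=\{1,\dots,n\}$. Let $P_\sigma$ be the poset of pairs $(i,\sigma(i))$, $i\in[n]$, with $(i,\sigma(i))\le(j,\sigma(j))$ if and only if $i\le j$ and $\sigma(i)\le\sigma(j)$. For $k\ge 0$ let $c_k$ (resp. $a_k$) be the maximal cardinality of a union of $k$ chains (resp. $k$ antichains) of $P_\sigma$. Let $P(\sigma)$ and $Q(\sigma)$ be the insertion tableau and the recording tableau computed by Schensted's algorithm: start with two empty tableaux and, for $i=1,\dots,n$, row-insert $\sigma(i)$ into the first one and add a box with entry $i$ to the second one at the position of the newly created box. Here, to row-insert $x$, replace by $x$ the leftmost entry of the first row that is greater than $x$ and insert the replaced entry into the next row in the same way, and so on; if a row has no entry greater than the element being inserted, then that element is appended at the end of the row and the insertion stops. Then $P(\sigma)$ and $Q(\sigma)$ have the same shape, and this common shape is $\lambda(P_\sigma)$, the Young diagram whose row lengths are $c_k-c_{k-1}$ and whose column lengths are $a_k-a_{k-1}$ for $k=1,2,\dots$. -/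

import Mathlib

namespace RobinsonSchensted

/-! ## The shape of a finite poset -/

/-- The cardinalities of the unions of `k` chains of `P` (chains may be empty or overlap). -/
def chainUnionSizes (P : Type*) [PartialOrder P] (k : ℕ) : Set ℕ :=
  {m | ∃ C : Fin k → Set P, (∀ t, IsChain (· ≤ ·) (C t)) ∧ (⋃ t, C t).ncard = m}

/-- The cardinalities of the unions of `k` antichains of `P`. -/
def antichainUnionSizes (P : Type*) [PartialOrder P] (k : ℕ) : Set ℕ :=
  {m | ∃ A : Fin k → Set P, (∀ t, IsAntichain (· ≤ ·) (A t)) ∧ (⋃ t, A t).ncard = m}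

/-- `c_k`: the maximal cardinality of a union of `k` chains of the finite poset `P`. -/
noncomputable def maxChainUnion (P : Type*) [PartialOrder P] (k : ℕ) : ℕ :=
  sSup (chainUnionSizes P k)

/-- `a_k`: the maximal cardinality of a union of `k` antichains of the finite poset `P`. -/
noncomputable def maxAntichainUnion (P : Type*) [PartialOrder P] (k : ℕ) : ℕ :=
  sSup (antichainUnionSizes P k)

/-- For a finite poset the supremum defining `c_k` is an attained maximum. -/
theorem isGreatest_maxChainUnion (P : Type*) [PartialOrder P] [Finite P] (k : ℕ) :
    IsGreatest (chainUnionSizes P k) (maxChainUnion P k) := by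
  have hb : BddAbove (chainUnionSizes P k) :=
    ⟨Nat.card P, by rintro m ⟨C, -, rfl⟩; exact Set.ncard_le_card _⟩
  have hne : (chainUnionSizes P k).Nonempty :=
    ⟨_, fun _ => ∅, fun _ => by simp [IsChain], rfl⟩
  exact ⟨Nat.sSup_mem hne hb, fun m hm => le_csSup hb hm⟩

/-- For a finite poset the supremum defining `a_k` is an attained maximum. -/
theorem isGreatest_maxAntichainUnion (P : Type*) [PartialOrder P] [Finite P] (k : ℕ) :
    IsGreatest (antichainUnionSizes P k) (maxAntichainUnion P k) := by
  have hb : BddAbove (antichainUnionSizes P k) :=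
    ⟨Nat.card P, by rintro m ⟨C, -, rfl⟩; exact Set.ncard_le_card _⟩
  have hne : (antichainUnionSizes P k).Nonempty :=
    ⟨_, fun _ => ∅, fun _ => by simp [IsAntichain], rfl⟩
  exact ⟨Nat.sSup_mem hne hb, fun m hm => le_csSup hb hm⟩

/-- `μ = λ(P)`: the row lengths of `μ` are the differences `c_{k+1} - c_k` and its column lengths
are the differences `a_{k+1} - a_k`, for `k = 0, 1, 2, …` (rows and columns of a `YoungDiagram` are
numbered from `0`). The row lengths alone determine `μ`. -/
def IsPosetShape (P : Type*) [PartialOrder P] (μ : YoungDiagram) : Prop :=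
  (∀ k, maxChainUnion P (k + 1) = maxChainUnion P k + μ.rowLen k) ∧
  (∀ k, maxAntichainUnion P (k + 1) = maxAntichainUnion P k + μ.colLen k)

/-! ## The permutation poset -/

/-- The permutation poset `P_σ`: the set of pairs `(i, σ i)`, ordered as a subset of the product of
two chains. -/
abbrev PermPoset {n : ℕ} (σ : Equiv.Perm (Fin n)) : Type :=
  {p : Fin n × Fin n // p.2 = σ p.1}

/-! ## Schensted's insertion algorithm -/

/-- A filling by elements of `α`, given as the list of its rows from top to bottom, each row
listed from left to right. -/
abbrev Filling (α : Type*) := List (List α)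

/-- Row insertion of `x`: `x` replaces the leftmost entry greater than `x`, which is returned as the
bumped entry; if there is no such entry then `x` is appended at the end and nothing is bumped. -/
def rowInsert {α : Type*} [LinearOrder α] (x : α) : List α → List α × Option α
  | [] => ([x], none)
  | y :: r => if x < y then (x :: r, some y) else (y :: (rowInsert x r).1, (rowInsert x r).2)

/-- Schensted insertion of `x` into a tableau: `x` is inserted into the first row, an entry bumped
from a row is inserted into the next one, until nothing is bumped. Returned together with the new
tableau is the index (from `0`) of the row in which the new box was created. -/
def schenstedInsert {α : Type*} [LinearOrder α] : α → Filling α → Filling α × ℕ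
  | x, [] => ([[x]], 0)
  | x, r :: T =>
    match rowInsert x r with
    | (r', none) => (r' :: T, 0)
    | (r', some y) => (r' :: (schenstedInsert y T).1, (schenstedInsert y T).2 + 1)

/-- Add a box with entry `a` at the end of the row with index `k` (a new last row if there are only
`k` rows). -/
def addBox {α : Type*} (a : α) : ℕ → Filling α → Filling α
  | _, [] => [[a]]
  | 0, r :: T => (r ++ [a]) :: T
  | k + 1, r :: T => r :: addBox a k T

/-- One step of the algorithm on a pair (insertion tableau, recording tableau): insert `σ i` in the
first one, and record `i` in the second one at the place of the new box. -/
def rsStep {n : ℕ} (σ : Equiv.Perm (Fin n)) (s : Filling (Fin n) × Filling (Fin n)) (i : Fin n) :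
    Filling (Fin n) × Filling (Fin n) :=
  ((schenstedInsert (σ i) s.1).1, addBox i (schenstedInsert (σ i) s.1).2 s.2)

/-- The pair `(P(σ), Q(σ))`, obtained from the pair of empty tableaux by performing the steps for
`σ 0, σ 1, …, σ (n - 1)` in this order. The chain `Fin n` plays the role of `[n]`. -/
def robinsonSchensted {n : ℕ} (σ : Equiv.Perm (Fin n)) : Filling (Fin n) × Filling (Fin n) :=
  (List.finRange n).foldl (rsStep σ) ([], [])

/-- The insertion tableau `P(σ)`. -/
def insertionTableau {n : ℕ} (σ : Equiv.Perm (Fin n)) : Filling (Fin n) :=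
  (robinsonSchensted σ).1

/-- The recording tableau `Q(σ)`. -/
def recordingTableau {n : ℕ} (σ : Equiv.Perm (Fin n)) : Filling (Fin n) :=
  (robinsonSchensted σ).2

/-- The filling `T` has shape `μ`: its row lengths, from top to bottom, are the (nonzero) row
lengths of the Young diagram `μ`. -/
def HasShape {α : Type*} (T : Filling α) (μ : YoungDiagram) : Prop :=
  T.map List.length = μ.rowLens

end RobinsonSchensted

/-!
Write `w` for the word of values. Greene's statistics of `w`, the largest numbers of letters covered
by `k` weakly increasing, respectively by `k` strictly decreasing, disjoint subwords, do not drop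
along the Knuth moves that lead from the reading word of `P(w)` back to `w`. The rows and the
columns of `P(w)` are increasing and decreasing subwords of its reading word, so `c_k` and `a_l` are
at least the number of cells in the first `k` rows and in the first `l` columns of the shape `μ` of
`P(w)`. On the other hand a chain meets an antichain in at most one element, whence
`c_k + a_l ≤ n + k * l`. When the `k × l` rectangle fits into `μ` and the first `k` rows and first
`l` columns exhaust `μ`, this forces equality in both lower bounds; such an `l` exists for every
`k`, and such a `k` for every `l`.
-/

namespace RobinsonSchensted

open Relation

variable {α β : Type*}

/-! ## Covers of a word by disjoint subwords -/

section Covers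

/-- A word of coloured letters such that the letters of each colour `c < k` form a subword in which
earlier letters are `R`-related to later ones. The colours `c ≥ k` stand for uncovered letters. -/
def IsColoring (R : α → α → Prop) (k : ℕ) (d : List (α × ℕ)) : Prop :=
  d.Pairwise fun p q => p.2 = q.2 → p.2 < k → R p.1 q.1

/-- Greene's statistic: the word `w` has `k` disjoint subwords of total length `m` in which earlier
letters are `R`-related to later ones. The subwords are the colour classes of a colouring. -/
def HasCover (R : α → α → Prop) (k m : ℕ) (w : List α) : Prop :=
  ∃ d : List (α × ℕ), d.map Prod.fst = w ∧ IsColoring R k d ∧ d.countP (·.2 < k) = m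

variable {R : α → α → Prop} {k m : ℕ}

theorem IsColoring.swap {u v : List (α × ℕ)} {p q : α × ℕ} (hqp : q.2 = p.2 → q.2 < k → R q.1 p.1)
    (h : IsColoring R k (u ++ p :: q :: v)) : IsColoring R k (u ++ q :: p :: v) := by
  simp only [IsColoring, List.pairwise_append, List.pairwise_cons, List.mem_cons,
    forall_eq_or_imp] at h ⊢
  grind

/-- An uncovered `y` takes the place of `x` in front of `z`. -/
theorem IsColoring.replace [IsTrans α R] {u v : List (α × ℕ)} {x y z : α} {s t : ℕ}
    (hpred : ∀ a, R a x → R a y) (hyz : R y z) (ht : k ≤ t)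
    (h : IsColoring R k (u ++ (y, t) :: (x, s) :: (z, s) :: v)) :
    IsColoring R k (u ++ (y, s) :: (z, s) :: (x, t) :: v) := by
  have trans_yz : ∀ a, R z a → R y a := fun a => IsTrans.trans y z a hyz
  simp only [IsColoring, List.pairwise_append, List.pairwise_cons, List.mem_cons,
    forall_eq_or_imp] at h ⊢
  grind

/-- The subwords through `y` and through `x z` exchange their initial parts: they continue as
`… y z …` and `… x …`. -/
theorem IsColoring.exchange [IsTrans α R] {u v : List (α × ℕ)} {x y z : α} {s t : ℕ}
    (hpred : ∀ a, R a x → R a y) (hsucc : ∀ a, R y a → R x a) (hyz : R y z)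
    (hs : s < k) (ht : t < k) (hst : s ≠ t)
    (h : IsColoring R k (u ++ (y, t) :: (x, s) :: (z, s) :: v)) :
    IsColoring R k
      (u.map (Prod.map id (Equiv.swap s t)) ++ (y, s) :: (z, s) :: (x, t) :: v) := by
  have trans : ∀ a b c, R a b → R b c → R a c := IsTrans.trans
  simp only [IsColoring, List.pairwise_append, List.pairwise_cons, List.mem_cons,
    forall_eq_or_imp, List.pairwise_map, List.forall_mem_map, Prod.map, Equiv.swap_apply_def] at h ⊢
  grind

theorem countP_map_swap_lt {s t : ℕ} (hs : s < k) (ht : t < k) (d : List (α × ℕ)) :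
    (d.map (Prod.map id (Equiv.swap s t))).countP (·.2 < k) = d.countP (·.2 < k) := by
  rw [List.countP_map]
  refine List.countP_congr fun p _ => ?_
  simp only [Function.comp_apply, Prod.map_snd, Equiv.swap_apply_def]
  grind

theorem HasCover.swap_of_rel {u v : List α} {x z : α} (hxz : R x z)
    (h : HasCover R k m (u ++ z :: x :: v)) : HasCover R k m (u ++ x :: z :: v) := by
  obtain ⟨d, hd, hcol, rfl⟩ := h
  obtain ⟨du, d', rfl, rfl, hd'⟩ := List.map_eq_append_iff.1 hd
  obtain ⟨⟨z, r⟩, d', rfl, rfl, hd''⟩ := List.map_eq_cons_iff.1 hd'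
  obtain ⟨⟨x, s⟩, dv, rfl, rfl, rfl⟩ := List.map_eq_cons_iff.1 hd''
  refine ⟨du ++ (x, s) :: (z, r) :: dv, by simp, hcol.swap fun _ _ => hxz, ?_⟩
  exact ((List.Perm.swap _ _ dv).append_left du).countP_eq _

theorem HasCover.swap_of_not_rel [IsTrans α R] (hR : ∀ a b c, R a c → R a b ∨ R b c) {u v : List α}
    {x y z : α} (hyx : ¬R y x) (hyz : R y z) (h : HasCover R k m (u ++ y :: x :: z :: v)) :
    HasCover R k m (u ++ y :: z :: x :: v) := by
  have hpred (a) (h : R a x) : R a y := (hR a y x h).resolve_right hyx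
  have hsucc (a) (h : R y a) : R x a := (hR y x a h).resolve_left hyx
  obtain ⟨d, hd, hcol, rfl⟩ := h
  obtain ⟨du, d', rfl, rfl, hd'⟩ := List.map_eq_append_iff.1 hd
  obtain ⟨⟨y, t⟩, d', rfl, rfl, hd''⟩ := List.map_eq_cons_iff.1 hd'
  obtain ⟨⟨x, s⟩, d', rfl, rfl, hd'''⟩ := List.map_eq_cons_iff.1 hd''
  obtain ⟨⟨z, r⟩, dv, rfl, rfl, rfl⟩ := List.map_eq_cons_iff.1 hd'''
  by_cases hxz : r = s ∧ s < k
  · obtain ⟨rfl, hr⟩ := hxz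
    rcases le_or_gt k t with ht | ht
    · refine ⟨_, by simp, hcol.replace hpred hyz ht, ?_⟩
      simp [List.countP_append, hr, ht.not_gt]
    · have hrt : r ≠ t := by
        rintro rfl
        simp only [IsColoring, List.pairwise_append, List.pairwise_cons, List.mem_cons] at hcol
        exact hyx (hcol.2.1.1 (x, r) (.inl rfl) rfl hr)
      refine ⟨_, by simp, hcol.exchange hpred hsucc hyz hr ht hrt, ?_⟩
      rw [List.countP_append, countP_map_swap_lt hr ht]
      simp [List.countP_append, hr, ht]
  · have hcol' : IsColoring R k ((du ++ [(y, t)]) ++ (z, r) :: (x, s) :: dv) :=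
      IsColoring.swap (fun hrs hr => (hxz ⟨hrs, hrs.symm.trans_lt hr⟩).elim) (by simpa using hcol)
    refine ⟨_, by simp, hcol', ?_⟩
    rw [List.append_assoc]
    exact (((List.Perm.swap _ _ dv).cons (y, t)).append_left du).countP_eq _

theorem hasCover_zero (R : α → α → Prop) (w : List α) : HasCover R 0 0 w :=
  ⟨w.map (·, 0), by simp [Function.comp_def],
    List.pairwise_of_forall fun _ _ _ h => (Nat.not_lt_zero _ h).elim, by simp⟩

theorem HasCover.append {u w : List α} (h : HasCover R k m w) (hu : u.Pairwise R) :
    HasCover R (k + 1) (m + u.length) (w ++ u) := by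
  obtain ⟨d, rfl, hcol, rfl⟩ := h
  refine ⟨d.map (Prod.map id Nat.succ) ++ u.map (·, 0), by simp [Function.comp_def], ?_, ?_⟩
  · simp only [IsColoring, List.pairwise_append, List.pairwise_map, List.forall_mem_map]
    exact ⟨hcol.imp fun h hc hk => h (Nat.succ.inj hc) (Nat.lt_of_succ_lt_succ hk),
      hu.imp fun h _ _ => h, fun _ _ _ _ h => (Nat.succ_ne_zero _ h).elim⟩
  · simp [List.countP_map, Function.comp_def]

theorem HasCover.of_map {S : β → β → Prop} {v : β → α} {L : List β}
    (hL : L.Pairwise fun p q => R (v p) (v q) → S p q) (h : HasCover R k m (L.map v)) :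
    HasCover S k m L := by
  obtain ⟨d, hd, hcol, rfl⟩ := h
  have hlen : d.length = L.length := by simpa using congrArg List.length hd
  obtain ⟨e, rfl, rfl⟩ : ∃ e : List (β × ℕ), e.map Prod.fst = L ∧ e.map (Prod.map v id) = d := by
    refine ⟨L.zip (d.map Prod.snd), List.map_fst_zip (by simp [hlen]), ?_⟩
    rw [← List.zip_map_left, ← hd, ← List.zip_of_prod rfl rfl]
  refine ⟨e, rfl, ?_, by simp [List.countP_map, Function.comp_def]⟩
  exact (List.pairwise_map.1 hcol).imp₂ (fun p q hR hS hc hk => hS (hR hc hk))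
    (List.pairwise_map.1 hL)

theorem HasCover.exists_ncard_iUnion [Std.Symm R] {w : List α} (hw : w.Nodup)
    (h : HasCover R k m w) :
    ∃ C : Fin k → Set α, (∀ t, (C t).Pairwise R) ∧ (⋃ t, C t).ncard = m := by
  classical
  obtain ⟨d, rfl, hcol, rfl⟩ := h
  refine ⟨fun t => {a | (a, t.1) ∈ d}, fun t a ha b hb hab => ?_, ?_⟩
  · let S (p q : α × ℕ) : Prop := p.2 = q.2 → p.2 < k → R p.1 q.1
    have : Std.Symm S := ⟨fun p q h hc hk => symm (h hc.symm (hc ▸ hk))⟩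
    exact List.Pairwise.forall (R := S) hcol ha hb (by simpa using hab) rfl t.2
  · have hcovered : (⋃ t : Fin k, {a | (a, t.1) ∈ d}) =
        ((d.filter (·.2 < k)).map Prod.fst).toFinset := by
      ext a
      simp [Fin.exists_iff, and_comm]
    rw [hcovered, Set.ncard_coe_finset, List.toFinset_card_of_nodup, List.length_map,
      List.countP_eq_length_filter]
    exact hw.sublist (List.filter_sublist.map _)

end Covers

variable [LinearOrder α]

/-! ## Knuth moves -/

section KnuthMoves

/-- The elementary Knuth transformations, oriented so that they lead from the reading word of a
tableau after an insertion to its reading word before the insertion followed by the inserted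
letter. -/
inductive KnuthMove : List α → List α → Prop
  | left (u v : List α) {a x y : α} (hax : a ≤ x) (hxy : x < y) :
      KnuthMove (u ++ y :: a :: x :: v) (u ++ a :: y :: x :: v)
  | right (u v : List α) {x y b : α} (hxy : x < y) (hyb : y ≤ b) :
      KnuthMove (u ++ y :: x :: b :: v) (u ++ y :: b :: x :: v)

variable {w w' : List α} {k m : ℕ}

theorem KnuthMove.perm (h : KnuthMove w w') : w.Perm w' := by
  cases h with
  | left u v => exact (List.Perm.swap _ _ _).append_left u
  | right u v => exact ((List.Perm.swap _ _ v).cons _).append_left u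

theorem KnuthMove.append_append (h : KnuthMove w w') (u v : List α) :
    KnuthMove (u ++ w ++ v) (u ++ w' ++ v) := by
  cases h with
  | left u' v' hax hxy => simpa using KnuthMove.left (u ++ u') (v' ++ v) hax hxy
  | right u' v' hxy hyb => simpa using KnuthMove.right (u ++ u') (v' ++ v) hxy hyb

theorem HasCover.of_knuthMove (h : KnuthMove w w') (hw : HasCover (· ≤ ·) k m w) :
    HasCover (· ≤ ·) k m w' := by
  cases h with
  | left u v hax hxy => exact hw.swap_of_rel (hax.trans hxy.le)
  | right u v hxy hyb =>
    exact hw.swap_of_not_rel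
      (fun _ b _ h => (le_total _ b).imp_right fun hb => hb.trans h) hxy.not_ge hyb

theorem HasCover.reverse_of_knuthMove (h : KnuthMove w w')
    (hw : HasCover (· < ·) k m w.reverse) : HasCover (· < ·) k m w'.reverse := by
  cases h with
  | left u v hax hxy =>
    simp only [List.reverse_append, List.reverse_cons, List.append_assoc, List.cons_append,
      List.nil_append] at hw ⊢
    exact hw.swap_of_not_rel (fun _ b _ h => (lt_or_ge _ b).imp_right fun hb => hb.trans_lt h)
      hax.not_gt hxy
  | right u v hxy hyb =>
    simp only [List.reverse_append, List.reverse_cons, List.append_assoc, List.cons_append,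
      List.nil_append] at hw ⊢
    exact hw.swap_of_rel (hxy.trans_le hyb)

theorem perm_of_knuthMoves (h : ReflTransGen KnuthMove w w') : w.Perm w' :=
  h.trans_induction_on (fun _ => .refl _) KnuthMove.perm fun _ _ => .trans

theorem knuthMoves_append_append (h : ReflTransGen KnuthMove w w') (u v : List α) :
    ReflTransGen KnuthMove (u ++ w ++ v) (u ++ w' ++ v) :=
  h.lift (u ++ · ++ v) fun _ _ h => h.append_append u v

theorem HasCover.of_knuthMoves (h : ReflTransGen KnuthMove w w')
    (hw : HasCover (· ≤ ·) k m w) : HasCover (· ≤ ·) k m w' :=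
  h.head_induction_on (motive := fun w _ => HasCover (· ≤ ·) k m w → _) id
    (fun h _ ih hw => ih (hw.of_knuthMove h)) hw

theorem HasCover.reverse_of_knuthMoves (h : ReflTransGen KnuthMove w w')
    (hw : HasCover (· < ·) k m w.reverse) : HasCover (· < ·) k m w'.reverse :=
  h.head_induction_on (motive := fun w _ => HasCover (· < ·) k m w.reverse → _) id
    (fun h _ ih hw => ih (hw.reverse_of_knuthMove h)) hw

theorem knuthMoves_left {x y : α} (hxy : x < y) {A : List α} (hA : A.Pairwise (· ≤ ·))
    (hAx : ∀ a ∈ A, a ≤ x) (v : List α) :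
    ReflTransGen KnuthMove (y :: (A ++ x :: v)) (A ++ y :: x :: v) := by
  induction A with
  | nil => exact .refl
  | cons a A ih =>
    rw [List.pairwise_cons] at hA
    rw [List.forall_mem_cons] at hAx
    have first : KnuthMove (y :: a :: (A ++ x :: v)) (a :: y :: (A ++ x :: v)) := by
      cases A with
      | nil => exact .left [] v hAx.1 hxy
      | cons b A =>
        exact .left [] (A ++ x :: v) (hA.1 b (by simp)) ((hAx.2 b (by simp)).trans_lt hxy)
    refine .head first ?_
    simpa using knuthMoves_append_append (ih hA.2 hAx.2) [a] []

theorem knuthMoves_right {x y : α} (hxy : x < y) {B : List α} (hB : (y :: B).Pairwise (· ≤ ·)) :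
    ReflTransGen KnuthMove (y :: x :: B) (y :: (B ++ [x])) := by
  induction B generalizing y with
  | nil => exact .refl
  | cons b B ih =>
    rw [List.pairwise_cons] at hB
    have hyb : y ≤ b := hB.1 b (by simp)
    refine .head (.right [] B hxy hyb) ?_
    simpa using knuthMoves_append_append (ih (hxy.trans_le hyb) hB.2) [y] []

theorem knuthMoves_bump {x y : α} (hxy : x < y) {A B : List α} (hAx : ∀ a ∈ A, a ≤ x)
    (hr : (A ++ y :: B).Pairwise (· ≤ ·)) :
    ReflTransGen KnuthMove (y :: (A ++ x :: B)) (A ++ y :: B ++ [x]) := by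
  obtain ⟨hA, hyB, -⟩ := List.pairwise_append.1 hr
  refine (knuthMoves_left hxy hA hAx B).trans ?_
  simpa using knuthMoves_append_append (knuthMoves_right hxy hyB) A []

end KnuthMoves

/-! ## Row insertion -/

theorem rowInsert_cases (x : α) (r : List α) :
    ((∀ a ∈ r, a ≤ x) ∧ rowInsert x r = (r ++ [x], none)) ∨
      ∃ A y B, r = A ++ y :: B ∧ (∀ a ∈ A, a ≤ x) ∧ x < y ∧
        rowInsert x r = (A ++ x :: B, some y) := by
  induction r with
  | nil => exact .inl ⟨by simp, rfl⟩
  | cons a r ih =>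
    by_cases hxa : x < a
    · exact .inr ⟨[], a, r, rfl, by simp, hxa, by simp [rowInsert, hxa]⟩
    have hax : a ≤ x := not_lt.1 hxa
    rcases ih with ⟨hr, h⟩ | ⟨A, y, B, rfl, hA, hxy, h⟩
    · exact .inl ⟨by simpa using ⟨hax, hr⟩, by simp [rowInsert, hxa, h]⟩
    · exact .inr ⟨a :: A, y, B, rfl, by simpa using ⟨hax, hA⟩, hxy, by simp [rowInsert, hxa, h]⟩

theorem rowInsert_fst_ne_nil (x : α) (r : List α) : (rowInsert x r).1 ≠ [] := by
  rcases rowInsert_cases x r with ⟨-, h⟩ | ⟨A, y, B, -, -, -, h⟩ <;> simp [h]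

theorem pairwise_rowInsert {r : List α} (hr : r.Pairwise (· ≤ ·)) (x : α) :
    (rowInsert x r).1.Pairwise (· ≤ ·) := by
  rcases rowInsert_cases x r with ⟨hrx, h⟩ | ⟨A, y, B, rfl, hA, hxy, h⟩
  · simpa [h, List.pairwise_append] using ⟨hr, hrx⟩
  · simp only [h, List.pairwise_append, List.pairwise_cons, List.forall_mem_cons] at hr ⊢
    exact ⟨hr.1, ⟨fun b hb => hxy.le.trans (hr.2.1.1 b hb), hr.2.1.2⟩,
      fun a ha => ⟨hA a ha, (hr.2.2 a ha).2⟩⟩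

theorem lt_of_rowInsert_snd_eq_some {x y : α} {r : List α} (h : (rowInsert x r).2 = some y) :
    x < y := by
  rcases rowInsert_cases x r with ⟨-, h'⟩ | ⟨A, z, B, -, -, hxz, h'⟩ <;> grind

/-! ## Tableaux -/

section Tableaux

/-- The row `s` may stand below the row `r` in a tableau: it is not longer, and each of its entries
is greater than the entry of `r` in the same column. -/
def RowAbove : List α → List α → Prop
  | _, [] => True
  | [], _ :: _ => False
  | a :: r, b :: s => a < b ∧ RowAbove r s

variable {r s t : List α} {T : Filling α}

@[simp]
theorem rowAbove_nil (r : List α) : RowAbove r [] := by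
  cases r <;> trivial

theorem RowAbove.length_le (h : RowAbove r s) : s.length ≤ r.length := by
  induction r generalizing s with
  | nil => cases s <;> simp_all [RowAbove]
  | cons a r ih =>
    cases s with
    | nil => simp
    | cons b s => simpa using ih h.2

theorem RowAbove.getElem?_lt (h : RowAbove r s) {i : ℕ} {a b : α} (ha : r[i]? = some a)
    (hb : s[i]? = some b) : a < b := by
  induction r generalizing s i with
  | nil => simp at ha
  | cons _ r ih =>
    cases s with
    | nil => simp at hb
    | cons _ s =>
      cases i with
      | zero =>
        obtain rfl : _ = a := by simpa using ha
        obtain rfl : _ = b := by simpa using hb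
        exact h.1
      | succ i => exact ih h.2 (by simpa using ha) (by simpa using hb)

theorem RowAbove.trans (hrs : RowAbove r s) (hst : RowAbove s t) : RowAbove r t := by
  induction r generalizing s t with
  | nil => cases s <;> cases t <;> simp_all [RowAbove]
  | cons a r ih =>
    cases s <;> cases t <;> simp only [RowAbove] at hrs hst ⊢
    exact ⟨hrs.1.trans hst.1, ih hrs.2 hst.2⟩

instance : IsTrans (List α) RowAbove := ⟨fun _ _ _ => RowAbove.trans⟩

theorem RowAbove.rowInsert_left (h : RowAbove r s) (x : α) : RowAbove (rowInsert x r).1 s := by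
  induction r generalizing s with
  | nil => cases s <;> simp_all [RowAbove]
  | cons a r ih =>
    cases s with
    | nil => simp
    | cons b s =>
      rw [rowInsert]
      split_ifs with hxa
      · exact ⟨hxa.trans h.1, h.2⟩
      · exact ⟨h.1, ih h.2⟩

theorem RowAbove.rowInsert_rowInsert (h : RowAbove r s) {x y : α}
    (hy : (rowInsert x r).2 = some y) : RowAbove (rowInsert x r).1 (rowInsert y s).1 := by
  induction r generalizing s with
  | nil => simp [rowInsert] at hy
  | cons a r ih =>
    have hxy : x < y := lt_of_rowInsert_snd_eq_some hy
    rw [rowInsert] at hy ⊢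
    split_ifs at hy ⊢ with hxa
    · obtain rfl : a = y := by simpa using hy
      cases s with
      | nil => exact ⟨hxa, rowAbove_nil _⟩
      | cons b s =>
        rw [rowInsert, if_pos h.1]
        exact ⟨hxa, h.2⟩
    · have hay : a < y := (not_lt.1 hxa).trans_lt hxy
      cases s with
      | nil => exact ⟨hay, rowAbove_nil _⟩
      | cons b s =>
        rw [rowInsert]
        split_ifs with hyb
        · exact ⟨hay, h.2.rowInsert_left x⟩
        · exact ⟨h.1, ih h.2 hy⟩

/-- Semistandard tableaux: rows are weakly increasing and columns are strictly increasing. -/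
structure IsTableau (T : Filling α) : Prop where
  ne_nil : ∀ r ∈ T, r ≠ []
  rows : ∀ r ∈ T, r.Pairwise (· ≤ ·)
  columns : T.IsChain RowAbove

/-- The reading word of a filling: its rows from bottom to top. -/
def readingWord (T : Filling β) : List β :=
  T.reverse.flatten

@[simp]
theorem readingWord_nil : readingWord ([] : Filling β) = [] :=
  rfl

@[simp]
theorem readingWord_cons (r : List β) (T : Filling β) :
    readingWord (r :: T) = readingWord T ++ r := by
  simp [readingWord]

theorem length_readingWord (T : Filling β) :
    (readingWord T).length = (T.map List.length).sum := by
  simp [readingWord, List.sum_reverse]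

theorem IsTableau.nil : IsTableau ([] : Filling α) :=
  ⟨by simp, by simp, .nil⟩

theorem isTableau_cons : IsTableau (r :: T) ↔
    r ≠ [] ∧ r.Pairwise (· ≤ ·) ∧ (∀ s ∈ T.head?, RowAbove r s) ∧ IsTableau T := by
  constructor
  · rintro ⟨hne, hrows, hcols⟩
    rw [List.forall_mem_cons] at hne hrows
    rw [List.isChain_cons] at hcols
    exact ⟨hne.1, hrows.1, hcols.1, hne.2, hrows.2, hcols.2⟩
  · rintro ⟨hr, hrow, hhead, hT⟩
    exact ⟨List.forall_mem_cons.2 ⟨hr, hT.ne_nil⟩, List.forall_mem_cons.2 ⟨hrow, hT.rows⟩,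
      List.isChain_cons.2 ⟨hhead, hT.columns⟩⟩

theorem head?_schenstedInsert (x : α) (T : Filling α) :
    (schenstedInsert x T).1.head? = some (rowInsert x (T.head?.getD [])).1 := by
  cases T with
  | nil => rfl
  | cons r T =>
    rcases rowInsert_cases x r with ⟨-, h⟩ | ⟨A, y, B, -, -, -, h⟩ <;> simp [schenstedInsert, h]

theorem IsTableau.insert (hT : IsTableau T) (x : α) :
    IsTableau (schenstedInsert x T).1 := by
  induction T generalizing x with
  | nil => simp [schenstedInsert, isTableau_cons, IsTableau.nil]
  | cons r T ih =>
    obtain ⟨-, hrow, hhead, hT'⟩ := isTableau_cons.1 hT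
    have hne := rowInsert_fst_ne_nil x r
    have hrow' := pairwise_rowInsert hrow x
    rw [schenstedInsert]
    split
    case h_1 r' h =>
      rw [h] at hne hrow'
      refine isTableau_cons.2 ⟨hne, hrow', fun s hs => ?_, hT'⟩
      simpa only [h] using (hhead s hs).rowInsert_left x
    case h_2 r' y h =>
      rw [h] at hne hrow'
      refine isTableau_cons.2 ⟨hne, hrow', ?_, ih hT' y⟩
      rw [head?_schenstedInsert]
      rintro s ⟨⟩
      have habove : RowAbove r (T.head?.getD []) := by
        cases T with
        | nil => simp
        | cons s T => exact hhead s rfl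
      simpa [h] using habove.rowInsert_rowInsert (x := x) (y := y) (by simp [h])

theorem IsTableau.knuthMoves_schenstedInsert (hT : IsTableau T) (x : α) :
    ReflTransGen KnuthMove (readingWord (schenstedInsert x T).1)
      (readingWord T ++ [x]) := by
  induction T generalizing x with
  | nil => exact .refl
  | cons r T ih =>
    obtain ⟨-, hrow, -, hT'⟩ := isTableau_cons.1 hT
    rcases rowInsert_cases x r with ⟨-, h⟩ | ⟨A, y, B, rfl, hA, hxy, h⟩
    · simp only [schenstedInsert, h, readingWord_cons, List.append_assoc]
      exact .refl
    · have below := knuthMoves_append_append (ih hT' y) [] (A ++ x :: B)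
      have bump := knuthMoves_append_append (knuthMoves_bump hxy hA hrow) (readingWord T) []
      simp only [schenstedInsert, h, readingWord_cons]
      simpa using below.trans (by simpa using bump)

theorem IsTableau.hasCover_readingWord (hT : IsTableau T) (k : ℕ) :
    HasCover (· ≤ ·) k ((T.map List.length).take k).sum (readingWord T) := by
  induction T generalizing k with
  | nil => exact ⟨[], by simp [IsColoring]⟩
  | cons r T ih =>
    obtain ⟨-, hrow, -, hT'⟩ := isTableau_cons.1 hT
    cases k with
    | zero => exact hasCover_zero _ _
    | succ k => simpa [add_comm] using (ih hT' k).append hrow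

theorem countP_zipIdx_lt (r : List β) (k i : ℕ) :
    (r.zipIdx i).countP (·.2 < k) = min r.length (k - i) := by
  induction r generalizing i with
  | nil => simp
  | cons a r ih =>
    simp only [List.zipIdx_cons, List.countP_cons, ih, List.length_cons, decide_eq_true_eq]
    split_ifs <;> omega

theorem IsTableau.hasCover_reverse_readingWord (hT : IsTableau T) (k : ℕ) :
    HasCover (· < ·) k ((T.map List.length).map (min · k)).sum (readingWord T).reverse := by
  -- the colour of an entry is its column
  refine ⟨(T.map fun r => r.zipIdx.reverse).flatten, ?_, List.pairwise_flatten.2 ⟨?_, ?_⟩, ?_⟩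
  · simp [readingWord, List.map_flatten, List.reverse_flatten, Function.comp_def]
  · simp only [List.forall_mem_map, List.pairwise_reverse]
    intro r _
    have hcol : (r.zipIdx.map Prod.snd).Nodup := by
      simpa using List.nodup_range'
    exact (List.pairwise_map.1 hcol).imp fun hne heq => (hne heq.symm).elim
  · refine List.pairwise_map.2 ((List.isChain_iff_pairwise.1 hT.columns).imp ?_)
    rintro r s hrs ⟨a, i⟩ ha ⟨b, j⟩ hb (rfl : i = j) -
    rw [List.mem_reverse, List.mem_zipIdx_iff_getElem?] at ha hb
    exact hrs.getElem?_lt ha hb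
  · simp [List.countP_flatten, Function.comp_def, countP_zipIdx_lt]

theorem IsTableau.exists_hasShape (hT : IsTableau T) : ∃ μ : YoungDiagram, HasShape T μ := by
  have hanti : (T.map List.length).SortedGE :=
    (List.pairwise_map.2
      ((List.isChain_iff_pairwise.1 hT.columns).imp RowAbove.length_le)).sortedGE
  refine ⟨.ofRowLens _ hanti, (YoungDiagram.rowLens_ofRowLens_eq_self ?_).symm⟩
  simpa [List.length_pos_iff] using hT.ne_nil

end Tableaux

/-! ## Sums over Young diagrams -/

section YoungDiagrams

open Finset

theorem card_filter_fst_lt (μ : YoungDiagram) (k : ℕ) :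
    #{c ∈ μ.cells | c.1 < k} = ∑ i ∈ range k, μ.rowLen i := by
  rw [card_eq_sum_card_fiberwise (f := Prod.fst) (t := range k) fun c hc => by simp_all]
  refine sum_congr rfl fun i hi => ?_
  rw [YoungDiagram.rowLen_eq_card, YoungDiagram.row, filter_filter]
  congr 1
  refine filter_congr fun c _ => and_iff_right_of_imp ?_
  rintro rfl
  exact mem_range.1 hi

theorem card_filter_snd_lt (μ : YoungDiagram) (l : ℕ) :
    #{c ∈ μ.cells | c.2 < l} = ∑ j ∈ range l, μ.colLen j := by
  simp_rw [← μ.rowLen_transpose, ← card_filter_fst_lt]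
  exact card_equiv (.prodComm ℕ ℕ) (by simp)

theorem sum_rowLen_add_sum_colLen {μ : YoungDiagram} {k l : ℕ}
    (hcover : ∀ c ∈ μ, c.1 < k ∨ c.2 < l) (hrect : ∀ i < k, ∀ j < l, (i, j) ∈ μ) :
    ∑ i ∈ range k, μ.rowLen i + ∑ j ∈ range l, μ.colLen j = μ.card + k * l := by
  have hinter : {c ∈ μ.cells | c.1 < k ∧ c.2 < l} = range k ×ˢ range l := by
    ext ⟨i, j⟩
    simpa using fun hi hj => hrect i hi j hj
  rw [← card_filter_fst_lt, ← card_filter_snd_lt, ← card_union_add_card_inter, ← filter_or,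
    ← filter_and, filter_true_of_mem hcover, hinter, card_product, card_range, card_range]

theorem sum_rowLen_add_sum_colLen_rowLen (μ : YoungDiagram) (k : ℕ) :
    ∑ i ∈ range k, μ.rowLen i + ∑ j ∈ range (μ.rowLen k), μ.colLen j =
      μ.card + k * μ.rowLen k := by
  refine sum_rowLen_add_sum_colLen ?_ fun i hi j hj => ?_
  · rintro ⟨i, j⟩ hij
    exact (lt_or_ge i k).imp_right fun hk =>
      (YoungDiagram.mem_iff_lt_rowLen.1 hij).trans_le (μ.rowLen_anti k i hk)
  · exact YoungDiagram.mem_iff_lt_rowLen.2 (hj.trans_le (μ.rowLen_anti i k hi.le))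

theorem sum_rowLen_colLen_add_sum_colLen (μ : YoungDiagram) (l : ℕ) :
    ∑ i ∈ range (μ.colLen l), μ.rowLen i + ∑ j ∈ range l, μ.colLen j =
      μ.card + μ.colLen l * l := by
  have hcard : μ.transpose.card = μ.card := card_map _
  simpa [hcard, add_comm, mul_comm] using sum_rowLen_add_sum_colLen_rowLen μ.transpose l

theorem rowLen_eq_zero {μ : YoungDiagram} {i : ℕ} (hi : μ.colLen 0 ≤ i) : μ.rowLen i = 0 := by
  by_contra h
  have hmem : (i, 0) ∈ μ := YoungDiagram.mem_iff_lt_rowLen.2 (Nat.pos_of_ne_zero h)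
  exact hi.not_gt (YoungDiagram.mem_iff_lt_colLen.1 hmem)

theorem sum_take_rowLens (μ : YoungDiagram) (k : ℕ) :
    (μ.rowLens.take k).sum = ∑ i ∈ range k, μ.rowLen i := by
  rw [YoungDiagram.rowLens, ← List.map_take, List.take_range]
  change ∑ i ∈ range (min k (μ.colLen 0)), μ.rowLen i = ∑ i ∈ range k, μ.rowLen i
  refine sum_subset (by simp) fun i hi hi' => rowLen_eq_zero ?_
  simp_all

theorem sum_map_min_rowLens (μ : YoungDiagram) (l : ℕ) :
    (μ.rowLens.map (min · l)).sum = ∑ j ∈ range l, μ.colLen j := by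
  have hrow (i : ℕ) : #{j ∈ range l | (i, j) ∈ μ} = min (μ.rowLen i) l := by
    rw [← card_range (min _ _)]
    congr 1
    ext j
    simp [YoungDiagram.mem_iff_lt_rowLen, and_comm]
  have hcol (j : ℕ) : #{i ∈ range (μ.colLen 0) | (i, j) ∈ μ} = μ.colLen j := by
    rw [← card_range (μ.colLen j)]
    congr 1
    ext i
    simpa [YoungDiagram.mem_iff_lt_colLen] using (μ.colLen_anti 0 j j.zero_le).trans_lt'
  calc (μ.rowLens.map (min · l)).sum
      = ∑ i ∈ range (μ.colLen 0), min (μ.rowLen i) l := by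
        rw [YoungDiagram.rowLens, List.map_map]; rfl
    _ = ∑ j ∈ range l, #{i ∈ range (μ.colLen 0) | (i, j) ∈ μ} := by
        simp_rw [← hrow]
        exact sum_card_bipartiteAbove_eq_sum_card_bipartiteBelow fun i j => (i, j) ∈ μ
    _ = ∑ j ∈ range l, μ.colLen j := by simp_rw [hcol]

theorem sum_rowLens (μ : YoungDiagram) : μ.rowLens.sum = μ.card := by
  have hcells : {c ∈ μ.cells | c.1 < μ.colLen 0} = μ.cells := by
    refine filter_true_of_mem ?_
    rintro ⟨i, j⟩ hij
    exact YoungDiagram.mem_iff_lt_colLen.1 (μ.up_left_mem le_rfl j.zero_le hij)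
  rw [YoungDiagram.card, ← hcells, card_filter_fst_lt]
  rfl

end YoungDiagrams

/-! ## Chains and antichains -/

section Posets

variable {P : Type*} [PartialOrder P] {k m : ℕ} {L : List P}

variable (P) in
theorem maxChainUnion_add_maxAntichainUnion_le [Finite P] (k l : ℕ) :
    maxChainUnion P k + maxAntichainUnion P l ≤ Nat.card P + k * l := by
  obtain ⟨C, hC, hc⟩ := (isGreatest_maxChainUnion P k).1
  obtain ⟨A, hA, ha⟩ := (isGreatest_maxAntichainUnion P l).1
  have hsub (t : Fin k) (s : Fin l) : (C t ∩ A s).Subsingleton :=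
    inter_subsingleton_of_isChain_of_isAntichain (hC t) (hA s)
  have hinter : ((⋃ t, C t) ∩ ⋃ s, A s).ncard ≤ k * l := by
    have hpairs : (⋃ t, C t) ∩ ⋃ s, A s = ⋃ ts : Fin k × Fin l, C ts.1 ∩ A ts.2 := by
      ext p
      simp
    calc ((⋃ t, C t) ∩ ⋃ s, A s).ncard
        ≤ ∑ ts : Fin k × Fin l, (C ts.1 ∩ A ts.2).ncard :=
          hpairs ▸ Set.ncard_iUnion_le_of_fintype _
      _ ≤ ∑ _ : Fin k × Fin l, 1 :=
          Finset.sum_le_sum fun ts _ => Set.ncard_le_one_iff_subsingleton.2 (hsub ts.1 ts.2)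
      _ = k * l := by simp
  calc maxChainUnion P k + maxAntichainUnion P l
      = ((⋃ t, C t) ∪ ⋃ s, A s).ncard + ((⋃ t, C t) ∩ ⋃ s, A s).ncard := by
        rw [← hc, ← ha, Set.ncard_union_add_ncard_inter]
    _ ≤ Nat.card P + k * l := Nat.add_le_add (Set.ncard_le_card _) hinter

theorem isPosetShape_of_sum_le [Finite P] {μ : YoungDiagram} (hcard : μ.card = Nat.card P)
    (hc : ∀ k, ∑ i ∈ Finset.range k, μ.rowLen i ≤ maxChainUnion P k)
    (ha : ∀ l, ∑ j ∈ Finset.range l, μ.colLen j ≤ maxAntichainUnion P l) :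
    IsPosetShape P μ := by
  have hc' (k : ℕ) : maxChainUnion P k = ∑ i ∈ Finset.range k, μ.rowLen i := by
    refine (hc k).antisymm' ?_
    linarith [maxChainUnion_add_maxAntichainUnion_le P k (μ.rowLen k), ha (μ.rowLen k),
      sum_rowLen_add_sum_colLen_rowLen μ k]
  have ha' (l : ℕ) : maxAntichainUnion P l = ∑ j ∈ Finset.range l, μ.colLen j := by
    refine (ha l).antisymm' ?_
    linarith [maxChainUnion_add_maxAntichainUnion_le P (μ.colLen l) l, hc (μ.colLen l),
      sum_rowLen_colLen_add_sum_colLen μ l]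
  exact ⟨fun k => by rw [hc', hc', Finset.sum_range_succ],
    fun l => by rw [ha', ha', Finset.sum_range_succ]⟩

theorem le_maxChainUnion [Finite P] (hL : L.Nodup)
    (h : HasCover (fun p q => p ≤ q ∨ q ≤ p) k m L) : m ≤ maxChainUnion P k := by
  have : Std.Symm fun p q : P => p ≤ q ∨ q ≤ p := ⟨fun _ _ => Or.symm⟩
  exact (isGreatest_maxChainUnion P k).2 (h.exists_ncard_iUnion hL)

theorem le_maxAntichainUnion [Finite P] (hL : L.Nodup)
    (h : HasCover (fun p q => ¬p ≤ q ∧ ¬q ≤ p) k m L) : m ≤ maxAntichainUnion P k := by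
  have : Std.Symm fun p q : P => ¬p ≤ q ∧ ¬q ≤ p := ⟨fun _ _ => And.symm⟩
  obtain ⟨A, hA, hm⟩ := h.exists_ncard_iUnion hL
  exact (isGreatest_maxAntichainUnion P k).2
    ⟨A, fun t => (hA t).imp fun _ _ => And.left, hm⟩

/-- A form of Greene's theorem; by `hL` the list `L` is a linear extension of `P`. -/
theorem isPosetShape_of_knuthMoves {T : Filling α} (hT : IsTableau T) {μ : YoungDiagram}
    (hμ : HasShape T μ) (hnodup : L.Nodup) (hmem : ∀ p, p ∈ L) {v : P → α}
    (hL : L.Pairwise fun p q => (p ≤ q ↔ v p ≤ v q) ∧ ¬q ≤ p)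
    (hmoves : ReflTransGen KnuthMove (readingWord T) (L.map v)) : IsPosetShape P μ := by
  classical
  have : Finite P := Set.finite_univ_iff.1 (L.finite_toSet.subset fun p _ => hmem p)
  have hcard : μ.card = Nat.card P := by
    rw [← sum_rowLens, ← hμ, ← length_readingWord, (perm_of_knuthMoves hmoves).length_eq,
      List.length_map, ← List.toFinset_card_of_nodup hnodup, ← Set.ncard_coe_finset,
      ← Set.ncard_univ]
    congr
    ext p
    simp [hmem p]
  refine isPosetShape_of_sum_le hcard (fun k => ?_) fun l => ?_
  · rw [← sum_take_rowLens, ← hμ]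
    exact le_maxChainUnion hnodup (((hT.hasCover_readingWord k).of_knuthMoves hmoves).of_map
      (hL.imp fun h hv => .inl (h.1.2 hv)))
  · rw [← sum_map_min_rowLens, ← hμ]
    have hcover := (hT.hasCover_reverse_readingWord l).reverse_of_knuthMoves hmoves
    rw [← List.map_reverse] at hcover
    exact le_maxAntichainUnion (List.nodup_reverse.2 hnodup) (hcover.of_map
      (List.pairwise_reverse.2 (hL.imp fun h hv => ⟨h.2, fun hpq => hv.not_ge (h.1.1 hpq)⟩)))

end Posets

/-! ## Schensted's algorithm -/

section Schensted

variable {ι : Type*}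

/-- The insertion and recording tableaux of the word with letters `f i`, for `i` in the list `L`;
the letter `f i` is recorded by `i`. -/
def schenstedPair (f : ι → α) (L : List ι) : Filling α × Filling ι :=
  L.foldl (fun s i => ((schenstedInsert (f i) s.1).1, addBox i (schenstedInsert (f i) s.1).2 s.2))
    ([], [])

theorem schenstedPair_append_singleton (f : ι → α) (L : List ι) (i : ι) :
    schenstedPair f (L ++ [i]) = ((schenstedInsert (f i) (schenstedPair f L).1).1,
      addBox i (schenstedInsert (f i) (schenstedPair f L).1).2 (schenstedPair f L).2) := by
  simp [schenstedPair]

theorem isTableau_schenstedPair_fst (f : ι → α) (L : List ι) :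
    IsTableau (schenstedPair f L).1 := by
  induction L using List.reverseRecOn with
  | nil => exact .nil
  | append_singleton L i ih =>
    rw [schenstedPair_append_singleton]
    exact ih.insert (f i)

theorem knuthMoves_schenstedPair (f : ι → α) (L : List ι) :
    ReflTransGen KnuthMove (readingWord (schenstedPair f L).1) (L.map f) := by
  induction L using List.reverseRecOn with
  | nil => exact .refl
  | append_singleton L i ih =>
    rw [schenstedPair_append_singleton, List.map_append]
    refine ((isTableau_schenstedPair_fst f L).knuthMoves_schenstedInsert (f i)).trans ?_
    exact knuthMoves_append_append ih [] [f i]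

theorem map_length_addBox_congr {S : Filling ι} {T : Filling β}
    (h : S.map List.length = T.map List.length) (a : ι) (b : β) (k : ℕ) :
    (addBox a k S).map List.length = (addBox b k T).map List.length := by
  induction S generalizing T k with
  | nil =>
    obtain rfl : T = [] := by simpa using h.symm
    simp [addBox]
  | cons r S ih =>
    obtain ⟨s, T, rfl, hs, hT⟩ := List.map_eq_cons_iff.1 h.symm
    cases k <;> simp [addBox, hs, hT, ih hT.symm]

theorem map_length_schenstedInsert (x : α) (T : Filling α) :
    (schenstedInsert x T).1.map List.length =
      (addBox x (schenstedInsert x T).2 T).map List.length := by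
  induction T generalizing x with
  | nil => rfl
  | cons r T ih =>
    rcases rowInsert_cases x r with ⟨-, h⟩ | ⟨A, y, B, rfl, -, -, h⟩
    · simp [schenstedInsert, h, addBox]
    · simpa [schenstedInsert, h, addBox, ih y] using map_length_addBox_congr rfl y x _

theorem map_length_schenstedPair (f : ι → α) (L : List ι) :
    (schenstedPair f L).2.map List.length = (schenstedPair f L).1.map List.length := by
  induction L using List.reverseRecOn with
  | nil => rfl
  | append_singleton L i ih =>
    rw [schenstedPair_append_singleton]
    exact (map_length_addBox_congr ih _ _ _).trans (map_length_schenstedInsert _ _).symm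

end Schensted

end RobinsonSchensted

open RobinsonSchensted

theorem theorem3p2_general {n : ℕ} {α : Type*} [LinearOrder α] (f : Fin n → α) :
    ∃ μ : YoungDiagram,
      HasShape (schenstedPair f (List.finRange n)).1 μ ∧
      HasShape (schenstedPair f (List.finRange n)).2 μ ∧
      IsPosetShape {p : Fin n × α // p.2 = f p.1} μ := by
  have hT := isTableau_schenstedPair_fst f (List.finRange n)
  obtain ⟨μ, hμ⟩ := hT.exists_hasShape
  refine ⟨μ, hμ, (map_length_schenstedPair f _).trans hμ, ?_⟩
  let point (i : Fin n) : {p : Fin n × α // p.2 = f p.1} := ⟨(i, f i), rfl⟩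
  have hpoint : Function.Injective point := fun i j h => congrArg (·.1.1) h
  refine isPosetShape_of_knuthMoves (L := (List.finRange n).map point) (v := fun p => p.1.2) hT hμ
    ((List.nodup_finRange n).map hpoint) ?_ (List.pairwise_map.2 ?_) ?_
  · exact fun p => List.mem_map.2 ⟨p.1.1, List.mem_finRange _, Subtype.ext (Prod.ext rfl p.2.symm)⟩
  · refine (List.pairwise_lt_finRange n).imp fun hij => ⟨?_, fun h => hij.not_ge h.1⟩
    exact ⟨fun h => h.2, fun h => ⟨hij.le, h⟩⟩
  · simpa [Function.comp_def, point] using knuthMoves_schenstedPair f (List.finRange n)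

theorem theorem3p2 (n : ℕ) (σ : Equiv.Perm (Fin n)) :
    ∃ μ : YoungDiagram,
      RobinsonSchensted.HasShape (RobinsonSchensted.insertionTableau σ) μ ∧
      RobinsonSchensted.HasShape (RobinsonSchensted.recordingTableau σ) μ ∧
      RobinsonSchensted.IsPosetShape (RobinsonSchensted.PermPoset σ) μ :=
  theorem3p2_general σ
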